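/- Let $d$ and $n$ be positive integers. Equip the sphere $S^d\subset\mathbb{R}^{d+1}$ with its geodesic metric $\mathrm{dist}(x,y)=\arccos\langle x,y\rangle$ and the antipodal involution $x\mapsto -x$, and equip real projective space $\mathbb{R}P^d=S^d/\{\pm1\}$ with the quotient metric, so that the distance between two points is the angle (in $[0,\pi/2]$) between the lines they determine in $\mathbb{R}^{d+1}$. For a compact metric space $X$ and an integer $m\ge 2$ let \[p_m(X)=\sup\{\varepsilon>0 : \text{there are } x_1,\dots,x_m\in X \text{ with } \mathrm{dist}(x_i,x_j)\ge\varepsilon \text{ for all } i\ne j\}.\] For a compact metric space $X$ with a free $\mathbb{Z}/2$-action $x\mapsto -x$, let the $\mathbb{Z}/2$-Carathéodory number $c_n(X)$ be the infimum of all $t\in[0,\infty)$ such that for every continuous odd map $f\colon X\to\mathbb{R}^n$ there is a set $A\subseteq X$ with $\mathrm{diam}(A)\le t$ and $0\in\mathrm{conv} f(A)$. Then \[c_n(S^d)\le \pi-p_{n+1}(\mathbb{R}P^d).\] Moreover, for every continuous odd map $f\colon S^d\to\mathbb{R}^n$ there is a set $A\subseteq S^d$ of diameter at most $\pi-p_{n+1}(\mathbb{R}P^d)$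 such that $0\in\mathrm{conv} f(A)$. -/

import Mathlib

open scoped LinearAlgebra.Projectivization

noncomputable section

/-- The unit sphere `S^d ⊆ ℝ^(d+1)`, as a type of its own so that it can carry the geodesic metric
instead of the chordal one. -/
def GeoSphere (d : ℕ) : Type := Metric.sphere (0 : EuclideanSpace ℝ (Fin (d + 1))) 1

namespace GeoSphere

variable {d : ℕ}

/-- A point of the sphere as a vector of `ℝ^(d+1)`. -/
def vec (x : GeoSphere d) : EuclideanSpace ℝ (Fin (d + 1)) := Subtype.val x

theorem norm_vec (x : GeoSphere d) : ‖x.vec‖ = 1 := mem_sphere_zero_iff_norm.mp x.2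

theorem vec_ne_zero (x : GeoSphere d) : x.vec ≠ 0 := by
  intro h
  have := x.norm_vec
  simp [h] at this

theorem vec_injective : Function.Injective (vec (d := d)) := Subtype.val_injective

/-- The antipodal involution `x ↦ -x`. -/
instance : InvolutiveNeg (GeoSphere d) :=
  inferInstanceAs (InvolutiveNeg (Metric.sphere (0 : EuclideanSpace ℝ (Fin (d + 1))) 1))

@[simp] theorem vec_neg (x : GeoSphere d) : (-x).vec = -x.vec := rfl

/-- The geodesic metric: the distance of two points is the angle between them. -/
instance : MetricSpace (GeoSphere d) where
  dist x y := InnerProductGeometry.angle x.vec y.vec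
  dist_self x := InnerProductGeometry.angle_self x.vec_ne_zero
  dist_comm x y := InnerProductGeometry.angle_comm _ _
  dist_triangle x y z := InnerProductGeometry.angle_le_angle_add_angle _ _ _
  eq_of_dist_eq_zero {x y} h := vec_injective
    (InnerProductGeometry.eq_of_angle_eq_zero_of_norm_eq h (by rw [x.norm_vec, y.norm_vec]))

theorem dist_eq_angle (x y : GeoSphere d) :
    dist x y = InnerProductGeometry.angle x.vec y.vec := rfl

theorem dist_eq_arccos (x y : GeoSphere d) :
    dist x y = Real.arccos (inner ℝ x.vec y.vec) := by
  simp [dist_eq_angle, InnerProductGeometry.angle, norm_vec]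

/-- The geodesic metric induces the usual topology of the sphere. -/
theorem exists_homeomorph : ∃ e : Metric.sphere (0 : EuclideanSpace ℝ (Fin (d + 1))) 1 ≃ₜ
    GeoSphere d, ∀ x, (e x).vec = x := by
  let e : Metric.sphere (0 : EuclideanSpace ℝ (Fin (d + 1))) 1 ≃ GeoSphere d := Equiv.refl _
  have he : Continuous e := by
    refine continuous_iff_continuousAt.2 fun x => ?_
    rw [ContinuousAt, tendsto_iff_dist_tendsto_zero]
    have hx : (x : EuclideanSpace ℝ (Fin (d + 1))) ≠ 0 := vec_ne_zero (e x)
    have h1 : ContinuousAt (fun y : Metric.sphere (0 : EuclideanSpace ℝ (Fin (d + 1))) 1 =>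
        InnerProductGeometry.angle (y : EuclideanSpace ℝ (Fin (d + 1))) x) x :=
      ContinuousAt.comp (f := fun y : Metric.sphere (0 : EuclideanSpace ℝ (Fin (d + 1))) 1 =>
          ((y : EuclideanSpace ℝ (Fin (d + 1))), (x : EuclideanSpace ℝ (Fin (d + 1)))))
        (InnerProductGeometry.continuousAt_angle hx hx) (by fun_prop)
    have h2 := h1.tendsto
    rw [InnerProductGeometry.angle_self hx] at h2
    exact h2
  exact ⟨he.homeoOfEquivCompactToT2, fun x => rfl⟩

instance : CompactSpace (GeoSphere d) :=
  let ⟨e, _⟩ := exists_homeomorph (d := d)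
  e.compactSpace

/-- The antipodal action is free. -/
theorem neg_ne_self (x : GeoSphere d) : -x ≠ x := by
  intro h
  have h1 : dist (-x) x = Real.pi := InnerProductGeometry.angle_neg_self_of_nonzero x.vec_ne_zero
  rw [h, dist_self] at h1
  exact Real.pi_ne_zero h1.symm

/-- The antipodal action is by isometries. -/
theorem isometry_neg : Isometry (fun x : GeoSphere d => -x) :=
  Isometry.of_dist_eq fun x y => by simp [dist_eq_angle]

end GeoSphere

namespace Projectivization

section

variable {V : Type*} [NormedAddCommGroup V] [InnerProductSpace ℝ V]

theorem min_angle_smul_left (v w : V) {t : ℝ} (ht : t ≠ 0) :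
    min (InnerProductGeometry.angle (t • v) w) (InnerProductGeometry.angle (t • v) (-w)) =
      min (InnerProductGeometry.angle v w) (InnerProductGeometry.angle v (-w)) := by
  rcases lt_or_gt_of_ne ht with h | h
  · rw [InnerProductGeometry.angle_smul_left_of_neg _ _ h,
      InnerProductGeometry.angle_smul_left_of_neg _ _ h, InnerProductGeometry.angle_neg_neg,
      min_comm, ← InnerProductGeometry.angle_neg_neg v (-w), neg_neg]
  · rw [InnerProductGeometry.angle_smul_left_of_pos _ _ h,
      InnerProductGeometry.angle_smul_left_of_pos _ _ h]

theorem min_angle_comm (v w : V) :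
    min (InnerProductGeometry.angle v w) (InnerProductGeometry.angle v (-w)) =
      min (InnerProductGeometry.angle w v) (InnerProductGeometry.angle w (-v)) := by
  rw [InnerProductGeometry.angle_comm v w, InnerProductGeometry.angle_comm v (-w),
    ← InnerProductGeometry.angle_neg_neg w (-v), neg_neg]

/-- The angle between two lines through the origin, `min (∠ v w) (∠ v (-w))` for nonzero vectors
`v` and `w` that span them. -/
def lineAngle (P Q : ℙ ℝ V) : ℝ :=
  min (InnerProductGeometry.angle P.rep Q.rep) (InnerProductGeometry.angle P.rep (-Q.rep))

/-- The angle between two lines may be computed from any nonzero vectors that span them. -/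
theorem lineAngle_mk_mk (v w : V) (hv : v ≠ 0) (hw : w ≠ 0) :
    lineAngle (mk ℝ v hv) (mk ℝ w hw) =
      min (InnerProductGeometry.angle v w) (InnerProductGeometry.angle v (-w)) := by
  obtain ⟨a, ha⟩ := exists_smul_eq_mk_rep ℝ v hv
  obtain ⟨b, hb⟩ := exists_smul_eq_mk_rep ℝ w hw
  rw [lineAngle, ← ha, ← hb, Units.smul_def, Units.smul_def, min_angle_smul_left _ _ a.ne_zero,
    min_angle_comm, min_angle_smul_left _ _ b.ne_zero, min_angle_comm]

/-- Projective space with the metric in which the distance of two points is the angle between the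
two lines. -/
instance : MetricSpace (ℙ ℝ V) where
  dist := lineAngle
  dist_self P := by
    rw [lineAngle, InnerProductGeometry.angle_self P.rep_nonzero]
    exact min_eq_left (InnerProductGeometry.angle_nonneg _ _)
  dist_comm P Q := min_angle_comm _ _
  dist_triangle P Q R := by
    have h1 := InnerProductGeometry.angle_le_angle_add_angle P.rep Q.rep R.rep
    have h2 := InnerProductGeometry.angle_le_angle_add_angle P.rep Q.rep (-R.rep)
    have h3 := InnerProductGeometry.angle_le_angle_add_angle P.rep (-Q.rep) R.rep
    have h4 := InnerProductGeometry.angle_le_angle_add_angle P.rep (-Q.rep) (-R.rep)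
    have h5 : InnerProductGeometry.angle (-Q.rep) R.rep =
        InnerProductGeometry.angle Q.rep (-R.rep) := by
      rw [← InnerProductGeometry.angle_neg_neg, neg_neg]
    rw [InnerProductGeometry.angle_neg_neg] at h4
    rw [h5] at h3
    simp only [lineAngle]
    grind
  eq_of_dist_eq_zero {P Q} h := by
    change min _ _ = (0 : ℝ) at h
    have key : ∀ s : ℝ, InnerProductGeometry.angle P.rep (s • Q.rep) = 0 → P = Q := by
      intro s hs
      obtain ⟨_, r, hr, hrs⟩ := InnerProductGeometry.angle_eq_zero_iff.mp hs
      rw [← P.mk_rep, ← Q.mk_rep, mk_eq_mk_iff']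
      exact ⟨r⁻¹ * s, by rw [mul_smul, hrs, smul_smul, inv_mul_cancel₀ hr.ne', one_smul]⟩
    rcases min_choice (InnerProductGeometry.angle P.rep Q.rep)
      (InnerProductGeometry.angle P.rep (-Q.rep)) with h' | h'
    · exact key 1 (by rw [one_smul, ← h', h])
    · exact key (-1) (by rw [neg_one_smul, ← h', h])

end

end Projectivization

/-- Real projective space `ℝP^d`: the lines through the origin of `ℝ^(d+1)`. -/
abbrev RealProjectiveSpace (d : ℕ) : Type := ℙ ℝ (EuclideanSpace ℝ (Fin (d + 1)))

/-- The antipodal quotient map `S^d → ℝP^d`. -/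
def GeoSphere.toProjective {d : ℕ} (x : GeoSphere d) : RealProjectiveSpace d :=
  Projectivization.mk ℝ x.vec x.vec_ne_zero

theorem GeoSphere.toProjective_surjective {d : ℕ} :
    Function.Surjective (GeoSphere.toProjective (d := d)) := by
  intro P
  have hP := norm_ne_zero_iff.mpr P.rep_nonzero
  refine ⟨⟨‖P.rep‖⁻¹ • P.rep, ?_⟩, ?_⟩
  · simp [norm_smul, inv_mul_cancel₀ hP]
  · conv_rhs => rw [← P.mk_rep]
    exact (Projectivization.mk_eq_mk_iff' ℝ _ _ _ _).mpr ⟨‖P.rep‖⁻¹, rfl⟩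

/-- The metric of `ℝP^d` is the quotient of the geodesic metric of `S^d` by the antipodal
action. -/
theorem GeoSphere.dist_toProjective {d : ℕ} (x y : GeoSphere d) :
    dist x.toProjective y.toProjective = min (dist x y) (dist x (-y)) :=
  Projectivization.lineAngle_mk_mk _ _ _ _

instance (d : ℕ) : CompactSpace (RealProjectiveSpace d) :=
  have h : Continuous (GeoSphere.toProjective (d := d)) :=
    (LipschitzWith.of_dist_le_mul (K := 1) fun x y => by
      rw [GeoSphere.dist_toProjective, NNReal.coe_one, one_mul]
      exact min_le_left _ _).continuous
  ⟨by
    rw [← GeoSphere.toProjective_surjective.range_eq]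
    exact isCompact_range h⟩

/-- `p_m(X)`: the supremum of the `ε > 0` for which `X` contains `m` points at pairwise distance at
least `ε`. It is meant for compact `X` with at least `m ≥ 2` points, where the set of these `ε` is
nonempty and bounded. -/
def codeDistance (X : Type*) [MetricSpace X] [CompactSpace X] (m : ℕ) : ℝ :=
  sSup {ε : ℝ | 0 < ε ∧ ∃ x : Fin m → X, ∀ i j, i ≠ j → ε ≤ dist (x i) (x j)}

/-- The `ℤ/2`-Carathéodory number `c_n(X)` of a compact metric space with an involution `x ↦ -x`:
the infimum of the `t ≥ 0` such that every continuous odd map `f : X → ℝ^n` has a set `A` of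
diameter at most `t` with `0 ∈ conv f(A)`. -/
def caratheodoryNumber (X : Type*) [MetricSpace X] [CompactSpace X] [InvolutiveNeg X] (n : ℕ) :
    ℝ :=
  sInf {t : ℝ | 0 ≤ t ∧ ∀ f : X → EuclideanSpace ℝ (Fin n), Continuous f → Function.Odd f →
    ∃ A : Set X, Metric.diam A ≤ t ∧ (0 : EuclideanSpace ℝ (Fin n)) ∈ convexHull ℝ (f '' A)}

end

/-! By compactness the supremum defining `codeDistance` is attained, so there are `n + 1` lines at
pairwise angle at least `p = codeDistance (RealProjectiveSpace d) (n + 1)`. Lift them to unit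
vectors `x i`. The `n + 1` vectors `f (x i)` in `ℝ^n` satisfy a nontrivial linear relation; as `f`
is odd, replacing `x i` by `-x i` wherever the coefficient is negative makes all coefficients
nonnegative, and normalising them puts `0` in the convex hull. The signs cannot be controlled, but
they do not matter: any lifts of two lines at angle at least `p` are at distance at least `p` from
each other's antipodes, hence at most `π - p` from each other. -/

/-- A compact metric space has `n + 1 ≥ 2` points whose pairwise distances are at least
`codeDistance`. -/
theorem exists_codeDistance_le_dist (X : Type*) [MetricSpace X] [CompactSpace X] [Nonempty X]
    {n : ℕ} (hn : 1 ≤ n) :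
    ∃ x : Fin (n + 1) → X, ∀ i j, i ≠ j → codeDistance X (n + 1) ≤ dist (x i) (x j) := by
  have hne : (Finset.univ : Finset (Fin (n + 1))).offDiag.Nonempty :=
    ⟨(0, Fin.last n), by simp [Fin.ext_iff]; omega⟩
  -- The least pairwise distance is continuous on the compact space `X^(n+1)`, so some configuration
  -- maximises it.
  let g : (Fin (n + 1) → X) → ℝ := fun x =>
    Finset.univ.offDiag.inf' hne fun p => dist (x p.1) (x p.2)
  have hg : Continuous g := Continuous.finset_inf'_apply hne fun p _ => by fun_prop
  obtain ⟨x, -, hx⟩ := isCompact_univ.exists_isMaxOn Set.univ_nonempty hg.continuousOn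
  have hle : ∀ i j, i ≠ j → g x ≤ dist (x i) (x j) := fun i j hij =>
    Finset.inf'_le (s := Finset.univ.offDiag) (b := (i, j)) (fun p => dist (x p.1) (x p.2))
      (by simpa using hij)
  refine ⟨x, fun i j hij => le_trans ?_ (hle i j hij)⟩
  -- The bound must also be nonnegative: if no `ε > 0` is admissible, the supremum is `sSup ∅ = 0`.
  refine Real.sSup_le ?_ (Finset.le_inf' _ _ fun p _ => dist_nonneg)
  rintro ε ⟨-, y, hy⟩
  exact (Finset.le_inf' hne _ fun p hp => hy _ _ (by simpa using hp)).trans (hx (Set.mem_univ y))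

namespace GeoSphere

variable {d : ℕ}

theorem dist_neg_right (x y : GeoSphere d) : dist x (-y) = Real.pi - dist x y := by
  simp only [dist_eq_angle, vec_neg, InnerProductGeometry.angle_neg_right]

/-- The projective distance is at most `dist x (-y) = π - dist x y`. This holds for every choice of
lifts, so the sign changes do no harm. -/
theorem dist_le_pi_sub_dist_toProjective (x y : GeoSphere d) :
    dist x y ≤ Real.pi - dist x.toProjective y.toProjective := by
  have h := min_le_right (dist x y) (dist x (-y))
  rw [← dist_toProjective, dist_neg_right] at h
  linarith

theorem toProjective_neg (x : GeoSphere d) : (-x).toProjective = x.toProjective :=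
  (Projectivization.mk_eq_mk_iff' ℝ _ _ _ _).mpr ⟨-1, by simp⟩

theorem dist_toProjective_le_pi (x y : GeoSphere d) :
    dist x.toProjective y.toProjective ≤ Real.pi := by
  have := dist_le_pi_sub_dist_toProjective x y
  linarith [dist_nonneg (x := x) (y := y)]

end GeoSphere

/-- An odd map to a space of dimension less than the number of the given points has, for some
choice of signs, the origin in the convex hull of the images of the signed points. -/
theorem Function.Odd.exists_signs_zero_mem_convexHull {X V ι : Type*} [InvolutiveNeg X]
    [AddCommGroup V] [Module ℝ V] [Module.Finite ℝ V] [Fintype ι] {f : X → V}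
    (hf : Function.Odd f) (x : ι → X) (h : Module.finrank ℝ V < Fintype.card ι) :
    ∃ y : ι → X, (∀ i, y i = x i ∨ y i = -x i) ∧ (0 : V) ∈ convexHull ℝ (f '' Set.range y) := by
  have hdep : ¬ LinearIndependent ℝ (f ∘ x) := fun hli =>
    absurd hli.fintype_card_le_finrank (not_le.mpr h)
  obtain ⟨c, hc, i₀, hi₀⟩ := Fintype.not_linearIndependent_iff.mp hdep
  -- The sign of `c i` moves into the point, leaving the weight `|c i|`.
  let y : ι → X := fun i => if 0 ≤ c i then x i else -x i
  have hy : ∀ i, |c i| • f (y i) = c i • f (x i) := fun i => by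
    by_cases hi : 0 ≤ c i
    · simp [y, hi, abs_of_nonneg hi]
    · simp [y, hi, abs_of_neg (not_le.mp hi), hf (x i)]
  -- Nontriviality of the relation allows division by the total weight.
  have hpos : 0 < ∑ i, |c i| :=
    Finset.sum_pos' (fun i _ => abs_nonneg _) ⟨i₀, Finset.mem_univ _, abs_pos.mpr hi₀⟩
  refine ⟨y, fun i => ?_, ?_⟩
  · by_cases hi : 0 ≤ c i <;> simp [y, hi]
  · have hmem := Finset.centerMass_mem_convexHull (R := ℝ) (s := f '' Set.range y)
      (t := Finset.univ) (w := fun i => |c i|) (z := f ∘ y) (fun i _ => abs_nonneg _) hpos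
      (fun i _ => ⟨y i, ⟨i, rfl⟩, rfl⟩)
    have hsum : ∑ i, |c i| • f (y i) = 0 := by simpa [hy] using hc
    simpa [Finset.centerMass, hsum] using hmem

theorem GeoSphere.exists_diam_le_zero_mem_convexHull {d n : ℕ} (hn : 1 ≤ n)
    {f : GeoSphere d → EuclideanSpace ℝ (Fin n)} (hf : Function.Odd f) :
    ∃ A : Set (GeoSphere d),
      Metric.diam A ≤ Real.pi - codeDistance (RealProjectiveSpace d) (n + 1) ∧
        (0 : EuclideanSpace ℝ (Fin n)) ∈ convexHull ℝ (f '' A) := by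
  obtain ⟨P, hP⟩ := exists_codeDistance_le_dist (RealProjectiveSpace d) hn
  choose x hx using fun i => GeoSphere.toProjective_surjective (P i)
  obtain ⟨y, hy, h0⟩ := hf.exists_signs_zero_mem_convexHull x (by simp)
  have hyP : ∀ i, (y i).toProjective = P i := fun i => by
    rcases hy i with h | h <;> rw [h]
    · exact hx i
    · rw [toProjective_neg, hx i]
  have hle : ∀ i j, i ≠ j →
      codeDistance (RealProjectiveSpace d) (n + 1) ≤ dist (y i).toProjective (y j).toProjective :=
    fun i j hij => by rw [hyP, hyP]; exact hP i j hij
  -- Needed for the diameter bound, where it covers the pairs with `i = j`; two distinct indices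
  -- exist because `n ≥ 1`.
  have hpi : 0 ≤ Real.pi - codeDistance (RealProjectiveSpace d) (n + 1) := by
    have h01 : (0 : Fin (n + 1)) ≠ Fin.last n := by simp [Fin.ext_iff]; omega
    linarith [hle _ _ h01, dist_toProjective_le_pi (y 0) (y (Fin.last n))]
  refine ⟨Set.range y, Metric.diam_le_of_forall_dist_le hpi ?_, h0⟩
  rintro _ ⟨i, rfl⟩ _ ⟨j, rfl⟩
  by_cases hij : i = j
  · simpa [hij] using hpi
  · linarith [hle i j hij, dist_le_pi_sub_dist_toProjective (y i) (y j)]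

theorem mainTheorem5 (d n : ℕ) (hd : 1 ≤ d) (hn : 1 ≤ n) :
    caratheodoryNumber (GeoSphere d) n ≤
        Real.pi - codeDistance (RealProjectiveSpace d) (n + 1) ∧
      ∀ f : GeoSphere d → EuclideanSpace ℝ (Fin n), Continuous f → Function.Odd f →
        ∃ A : Set (GeoSphere d),
          Metric.diam A ≤ Real.pi - codeDistance (RealProjectiveSpace d) (n + 1) ∧
            (0 : EuclideanSpace ℝ (Fin n)) ∈ convexHull ℝ (f '' A) := by
  have key : ∀ f : GeoSphere d → EuclideanSpace ℝ (Fin n), Continuous f → Function.Odd f →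
      ∃ A : Set (GeoSphere d),
        Metric.diam A ≤ Real.pi - codeDistance (RealProjectiveSpace d) (n + 1) ∧
          (0 : EuclideanSpace ℝ (Fin n)) ∈ convexHull ℝ (f '' A) :=
    fun f _ hf => GeoSphere.exists_diam_le_zero_mem_convexHull hn hf
  refine ⟨csInf_le ⟨0, fun t ht => ht.1⟩ ⟨?_, key⟩, key⟩
  -- The zero map is odd, and the set it yields has nonnegative diameter, so the bound is itself
  -- nonnegative.
  obtain ⟨A, hA, -⟩ := key (fun _ => 0) continuous_const fun _ => by simp
  exact Metric.diam_nonneg.trans hA
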